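/- Let $I \ge 1$, $K \ge 0$, and $c_{jk} \in \{1,0,-1\}$ for $1\le j\le I$, $1\le k\le K$. In every period $t = 1,2,\dots$ the signals $$q_j = A_j + \sum_{k=1}^K c_{jk}\Theta_k + \epsilon^q_j \quad (j = 1,\dots,I), \qquad \eta_k = \Theta_k + \epsilon^\eta_k \quad (k = 1,\dots,K)$$ are observed, where the true calibers $A_j \in \mathbb R$ and the true levels of discrimination $\Theta_k \in \mathbb R$ are fixed over time, and all the errors are independent across components and periods and normal with mean zero and variances $v^q_j > 0$ and $v^\eta_k > 0$, respectively. Agent $i \in \{1,\dots,I\}$ knows the $c_{jk}$ and starts from a prior probability measure $\mathbf P_0$ on triples $(a,\theta,S) \in \mathbb R^I\times\mathbb R^K\times\mathbb R^{(I+K)\times(I+K)}$ that is concentrated on, and has full support in, the set $$\{(a,\theta,S) : a_i = \tilde a_i,\ S \text{ symmetric positive definite}\},$$ where $\tilde a_i > A_i$ (the agent is overconfident). After $t$ periods his belief $\mathbf P_t$ is the Bayesian posterior, where under $(a,\theta,S)$ the signal vectors of different periods are independent and normally distributed, with means $a_j + \sum_k c_{jk}\theta_k$ for $q_j$ and $\theta_k$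 for $\eta_k$ and with covariance matrix $S$. Then there is a non-random point $(\tilde a^i,\tilde\theta^i,\tilde S^i)$ with $\tilde a^i_i = \tilde a_i$ and $\tilde S^i$ positive definite such that, almost surely, this is the one and only point on which the beliefs concentrate, that is, all of whose open neighbourhoods $B$ satisfy $\lim_{t\to\infty}\mathbf P_t(B) = 1$. The agent's long-run bias about discrimination toward group $k$ is, for every $k$, $$\tilde\theta^i_k - \Theta_k = \frac{-c_{ik}v^\eta_k}{v^q_i + \sum_{k'} c_{ik'}^2 v^\eta_{k'}}\,(\tilde a_i - A_i),$$ and his long-run bias about the caliber of individual $j$ is, for every $j \neq i$, $$\tilde a^i_j - A_j = \frac{\sum_k c_{ik}c_{jk}v^\eta_k}{v^q_i + \sum_k c_{ik}^2 v^\eta_k}\,(\tilde a_i - A_i).$$ -/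

import Mathlib

open MeasureTheory ProbabilityTheory Filter Topology
open scoped NNReal ENNReal Matrix

noncomputable section

namespace SocialBeliefs

/-- Index set of one observation: `inl j` is the recognition `q_j` of individual `j`,
`inr k` is the signal `η_k` about discrimination toward group `k`. -/
abbrev Obs (I K : ℕ) : Type := Fin I ⊕ Fin K

/-- A parameter `(a, θ, S)`: calibers, levels of discrimination, covariance matrix of
all the errors. -/
abbrev Param (I K : ℕ) : Type :=
  (Fin I → ℝ) × (Fin K → ℝ) × Matrix (Obs I K) (Obs I K) ℝ

/-- The entrywise (equivalently, the Borel) `σ`-algebra on matrices. -/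
instance instMeasurableSpaceMatrix (I K : ℕ) :
    MeasurableSpace (Matrix (Obs I K) (Obs I K) ℝ) :=
  inferInstanceAs (MeasurableSpace (Obs I K → Obs I K → ℝ))

instance instBorelSpaceMatrix (I K : ℕ) : BorelSpace (Matrix (Obs I K) (Obs I K) ℝ) :=
  inferInstanceAs (BorelSpace (Obs I K → Obs I K → ℝ))

instance instSecondCountableMatrix (I K : ℕ) :
    SecondCountableTopology (Matrix (Obs I K) (Obs I K) ℝ) :=
  inferInstanceAs (SecondCountableTopology (Obs I K → Obs I K → ℝ))

/-- The error-free part of an observation: `q_j = a_j + ∑ k, c_jk θ_k` and `η_k = θ_k`. -/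
def meanObs {I K : ℕ} (c : Fin I → Fin K → ℝ) (a : Fin I → ℝ) (θ : Fin K → ℝ) :
    Obs I K → ℝ :=
  Sum.elim (fun j => a j + ∑ k, c j k * θ k) θ

/-- The density at `r` of the normal distribution with mean `meanObs c a θ` and covariance
matrix `S`, where `x = (a, θ, S)` and `S` is positive definite. -/
def obsDensity {I K : ℕ} (c : Fin I → Fin K → ℝ) (x : Param I K) (r : Obs I K → ℝ) : ℝ :=
  (√((2 * Real.pi) ^ (I + K) * x.2.2.det))⁻¹ *
    Real.exp (-(1 / 2) *
      ((r - meanObs c x.1 x.2.1) ⬝ᵥ (x.2.2⁻¹ *ᵥ (r - meanObs c x.1 x.2.1))))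

/-- The likelihood of the first `t` observations `r 0, …, r (t - 1)`. -/
def likelihood {I K : ℕ} (c : Fin I → Fin K → ℝ) (r : ℕ → Obs I K → ℝ) (t : ℕ)
    (x : Param I K) : ℝ :=
  ∏ z ∈ Finset.range t, obsDensity c x (r z)

/-- Bayes' rule: the probability of `B` after the first `t` observations, from the prior `P₀`. -/
def posterior {I K : ℕ} (c : Fin I → Fin K → ℝ) (P₀ : Measure (Param I K))
    (r : ℕ → Obs I K → ℝ) (t : ℕ) (B : Set (Param I K)) : ℝ≥0∞ :=
  (∫⁻ x in B, ENNReal.ofReal (likelihood c r t x) ∂P₀) /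
    ∫⁻ x, ENNReal.ofReal (likelihood c r t x) ∂P₀

/-- Beliefs `Q 0, Q 1, …` concentrate on the point `x`: every open set containing `x` has
probability tending to one. -/
def ConcentratesOn {X : Type*} [TopologicalSpace X] (Q : ℕ → Set X → ℝ≥0∞) (x : X) : Prop :=
  ∀ B : Set X, IsOpen B → x ∈ B → Tendsto (fun t => Q t B) atTop (𝓝 1)

/-- The parameters agent `i` deems possible when he is certain that his own caliber is `ai`:
everything else is unrestricted, except that the covariance matrix is positive definite. -/
def possible {I K : ℕ} (i : Fin I) (ai : ℝ) : Set (Param I K) :=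
  {x | x.1 i = ai ∧ x.2.2.PosDef}

/-- `P₀` is a prior of agent `i`: a probability measure that is concentrated on `possible i ai`
and has full support there. -/
structure IsPrior {I K : ℕ} (i : Fin I) (ai : ℝ) (P₀ : Measure (Param I K)) : Prop where
  isProbabilityMeasure : IsProbabilityMeasure P₀
  ae_mem : ∀ᵐ x ∂P₀, x ∈ possible i ai
  full_support : possible i ai ⊆ P₀.support

end SocialBeliefs

end

/-! A parameter enters the likelihood only through its covariance matrix `S` and its deviation `δ`,
the true mean minus the believed one. Twice the average negative log-likelihood tends, up to a
constant, to `log det S + tr (S⁻¹ (diag v + δ δᵀ))`. For fixed `δ`, nonnegativity of the Gaussian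
relative entropy makes `S = diag v + δ δᵀ` optimal, and by the matrix determinant lemma the optimal
value is strictly increasing in `∑ δ_d² / v_d`. Certainty about `a_i` prescribes just one linear
functional `w · δ = A_i - ai`, where `w` is `1` at `q_i` and `-c_ik` at `η_k`. So the best deviation
is the projection of `0` onto a hyperplane, `δ₀` proportional to `v w`, and both bias formulas are
read off from it.

The possible set is not compact (`S` may degenerate or blow up), so the loss does not converge
uniformly. Three facts replace compactness: the sampling error is at most a small fraction of the
trace term (`eventually_abs_avg_quadForm_sub_le`); half of the trace term can be spared to absorb it
(`le_log_det_add_half_trace`); and near-minimal loss forces the parameter to be near the minimizer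
(`tendsto_of_tendsto_gaussLoss`). `concentratesOn_shiftedParam` combines them with the likelihood
comparison `tendsto_likelihoodShare_one`. -/

noncomputable section

namespace SocialBeliefs

/-! ### Positive definite matrices and Stein loss -/

section Matrices

/-- Young's inequality, from nonnegativity of the form at `b ± η d`. -/
theorem two_mul_abs_dotProduct_mulVec_le {n : Type*} [Fintype n] {Q : Matrix n n ℝ} (hQ : Q.PosSemidef) {η : ℝ}
    (hη : 0 < η) (b d : n → ℝ) :
    2 * |b ⬝ᵥ Q *ᵥ d| ≤ η⁻¹ * (b ⬝ᵥ Q *ᵥ b) + η * (d ⬝ᵥ Q *ᵥ d) := by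
  have hsymm : d ⬝ᵥ Q *ᵥ b = b ⬝ᵥ Q *ᵥ d := by
    have hQt : Qᵀ = Q := by simpa using hQ.1.eq
    rw [dotProduct_comm, ← Matrix.vecMul_transpose, hQt, ← Matrix.dotProduct_mulVec]
  have h1 : 0 ≤ (b + η • d) ⬝ᵥ Q *ᵥ (b + η • d) := by
    simpa using hQ.dotProduct_mulVec_nonneg (b + η • d)
  have h2 : 0 ≤ (b - η • d) ⬝ᵥ Q *ᵥ (b - η • d) := by
    simpa using hQ.dotProduct_mulVec_nonneg (b - η • d)
  simp only [Matrix.mulVec_add, Matrix.mulVec_sub, dotProduct_add, add_dotProduct, dotProduct_sub,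
    sub_dotProduct, Matrix.mulVec_smul, dotProduct_smul, smul_dotProduct, smul_eq_mul, hsymm]
    at h1 h2
  have key : η * (2 * |b ⬝ᵥ Q *ᵥ d|) ≤ b ⬝ᵥ Q *ᵥ b + η * (η * (d ⬝ᵥ Q *ᵥ d)) := by
    rcases abs_cases (b ⬝ᵥ Q *ᵥ d) with ⟨h, -⟩ | ⟨h, -⟩ <;> rw [h] <;> linarith
  have h3 := mul_le_mul_of_nonneg_left key (inv_pos.2 hη).le
  rwa [inv_mul_cancel_left₀ hη.ne', mul_add, inv_mul_cancel_left₀ hη.ne'] at h3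

variable {n : Type*} [Fintype n] [DecidableEq n]

/-- Apply `log x ≤ x - 1` at `x = √μ` and double. -/
theorem sq_sqrt_sub_one_le {μ : ℝ} (hμ : 0 < μ) : (√μ - 1) ^ 2 ≤ μ - 1 - Real.log μ := by
  have h1 := Real.log_le_sub_one_of_pos (Real.sqrt_pos.2 hμ)
  rw [Real.log_sqrt hμ.le] at h1
  nlinarith [Real.sq_sqrt hμ.le]

theorem abs_sub_one_le_of_sub_log_le {μ κ : ℝ} (hμ : 0 < μ) (h : μ - 1 - Real.log μ ≤ κ) :
    |μ - 1| ≤ √κ * (2 + √κ) := by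
  have h1 : |√μ - 1| ≤ √κ := Real.abs_le_sqrt ((sq_sqrt_sub_one_le hμ).trans h)
  have h2 : μ - 1 = (√μ - 1) * (2 + (√μ - 1)) := by nlinarith [Real.sq_sqrt hμ.le]
  rw [h2, abs_mul]
  refine mul_le_mul h1 ?_ (abs_nonneg _) (Real.sqrt_nonneg _)
  exact (abs_add_le _ _).trans (by rw [abs_two]; linarith)

theorem trace_sub_log_det_eq_sum {N : Matrix n n ℝ} (hN : N.PosDef) :
    N.trace - Fintype.card n - Real.log N.det =
      ∑ i, (hN.1.eigenvalues i - 1 - Real.log (hN.1.eigenvalues i)) := by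
  rw [hN.1.trace_eq_sum_eigenvalues, hN.1.det_eq_prod_eigenvalues, Finset.sum_sub_distrib,
    Finset.sum_sub_distrib]
  simp [Real.log_prod (fun i _ => (hN.eigenvalues_pos i).ne')]

theorem sub_one_sub_log_nonneg {μ : ℝ} (hμ : 0 < μ) : 0 ≤ μ - 1 - Real.log μ := by
  linarith [Real.log_le_sub_one_of_pos hμ]

theorem trace_sub_log_det_nonneg {N : Matrix n n ℝ} (hN : N.PosDef) :
    0 ≤ N.trace - Fintype.card n - Real.log N.det := by
  rw [trace_sub_log_det_eq_sum hN]
  exact Finset.sum_nonneg fun i _ => sub_one_sub_log_nonneg (hN.eigenvalues_pos i)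

/-- A positive definite matrix whose Stein loss is small is close to the identity. -/
theorem abs_quadForm_sub_le_of_trace_sub_log_det_le {N : Matrix n n ℝ} (hN : N.PosDef) {κ : ℝ}
    (h : N.trace - Fintype.card n - Real.log N.det ≤ κ) (y : n → ℝ) :
    |y ⬝ᵥ N *ᵥ y - y ⬝ᵥ y| ≤ √κ * (2 + √κ) * (y ⬝ᵥ y) := by
  set μ := hN.1.eigenvalues with hμ
  set U : Matrix n n ℝ := hN.1.eigenvectorUnitary.1 with hU
  have hUU : U * Uᵀ = 1 := by
    have := Unitary.mul_star_self_of_mem hN.1.eigenvectorUnitary.2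
    simpa [Matrix.star_eq_conjTranspose] using this
  have hspec : N = U * Matrix.diagonal μ * Uᵀ := by
    have := hN.1.spectral_theorem
    rw [Unitary.conjStarAlgAut_apply] at this
    simpa [Matrix.star_eq_conjTranspose] using this
  have hμle : ∀ i, |μ i - 1| ≤ √κ * (2 + √κ) := fun i => by
    refine abs_sub_one_le_of_sub_log_le (hN.eigenvalues_pos i) (le_trans ?_ h)
    rw [trace_sub_log_det_eq_sum hN]
    exact Finset.single_le_sum
      (f := fun i => hN.1.eigenvalues i - 1 - Real.log (hN.1.eigenvalues i))
      (fun i _ => sub_one_sub_log_nonneg (hN.eigenvalues_pos i)) (Finset.mem_univ i)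
  set z := Uᵀ *ᵥ y with hz
  have hyy : y ⬝ᵥ y = ∑ i, z i ^ 2 := by
    have : y ⬝ᵥ y = z ⬝ᵥ z := by
      rw [hz, Matrix.dotProduct_mulVec, Matrix.vecMul_transpose, Matrix.mulVec_mulVec, hUU,
        Matrix.one_mulVec]
    rw [this]
    simp [dotProduct, sq]
  have hyN : y ⬝ᵥ N *ᵥ y = ∑ i, μ i * z i ^ 2 := by
    have : y ⬝ᵥ N *ᵥ y = z ⬝ᵥ Matrix.diagonal μ *ᵥ z := by
      rw [hspec, ← Matrix.mulVec_mulVec, ← Matrix.mulVec_mulVec, Matrix.dotProduct_mulVec y U,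
        ← Matrix.mulVec_transpose]
    rw [this]
    simp only [dotProduct, Matrix.mulVec_diagonal]
    exact Finset.sum_congr rfl fun i _ => by ring
  rw [hyN, hyy, ← Finset.sum_sub_distrib, Finset.mul_sum]
  refine (Finset.abs_sum_le_sum_abs _ _).trans (Finset.sum_le_sum fun i _ => ?_)
  rw [← sub_one_mul, abs_mul, abs_of_nonneg (sq_nonneg (z i))]
  exact mul_le_mul_of_nonneg_right (hμle i) (sq_nonneg _)

open scoped MatrixOrder in
theorem exists_transpose_mul_self_eq {S : Matrix n n ℝ} (hS : S.PosDef) :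
    ∃ B : Matrix n n ℝ, IsUnit B.det ∧ S = Bᵀ * B := by
  obtain ⟨B, hB⟩ := CStarAlgebra.nonneg_iff_eq_star_mul_self.mp hS.posSemidef.nonneg
  have hB' : S = Bᵀ * B := by simpa [Matrix.star_eq_conjTranspose] using hB
  refine ⟨B, ?_, hB'⟩
  have := hS.det_pos
  rw [hB', Matrix.det_mul, Matrix.det_transpose] at this
  exact (mul_self_pos.1 this).isUnit

/-- Whitening `W` by a factor of `S`. -/
theorem exists_whitening {S W : Matrix n n ℝ} (hS : S.PosDef) (hW : W.PosDef) :
    ∃ B N : Matrix n n ℝ, N.PosDef ∧ N.trace = (S⁻¹ * W).trace ∧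
      Real.log N.det = Real.log W.det - Real.log S.det ∧ S = Bᵀ * B ∧ W = Bᵀ * N * B := by
  obtain ⟨B, hB, hSB⟩ := exists_transpose_mul_self_eq hS
  have hBt : IsUnit Bᵀ.det := by rwa [Matrix.det_transpose]
  have hBu : IsUnit B := (Matrix.isUnit_iff_isUnit_det B).2 hB
  refine ⟨B, (B⁻¹)ᵀ * W * B⁻¹, ?_, ?_, ?_, hSB, ?_⟩
  · have := hW.conjTranspose_mul_mul_same (B := B⁻¹)
      (Matrix.mulVec_injective_of_isUnit (by simpa using hBu))
    simpa using this
  · rw [hSB, Matrix.mul_inv_rev, Matrix.transpose_nonsing_inv, Matrix.trace_mul_comm,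
      Matrix.mul_assoc]
  · have hdet : S.det = B.det * B.det := by rw [hSB, Matrix.det_mul, Matrix.det_transpose]
    rw [hdet, ← Real.log_div hW.det_pos.ne' (mul_ne_zero hB.ne_zero hB.ne_zero), Matrix.det_mul,
      Matrix.det_mul, Matrix.det_transpose, Matrix.det_nonsing_inv, Ring.inverse_eq_inv']
    congr 1
    field_simp
  · rw [Matrix.transpose_nonsing_inv, Matrix.mul_assoc Bᵀ⁻¹,
      Matrix.mul_nonsing_inv_cancel_left _ _ hBt, Matrix.mul_assoc, Matrix.nonsing_inv_mul _ hB, Matrix.mul_one]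

/-- This is twice the relative entropy of centred normal laws. Whitening by a factor of `S` reduces
it to `μ - 1 - log μ ≥ 0` for each eigenvalue `μ`. -/
theorem steinLoss_nonneg {S W : Matrix n n ℝ} (hS : S.PosDef) (hW : W.PosDef) :
    0 ≤ Real.log S.det + (S⁻¹ * W).trace - (Real.log W.det + Fintype.card n) := by
  obtain ⟨B, N, hN, htr, hdet, -, -⟩ := exists_whitening hS hW
  have := trace_sub_log_det_nonneg hN
  rw [htr, hdet] at this
  linarith

theorem abs_quadForm_sub_le_of_steinLoss_le {S W : Matrix n n ℝ} (hS : S.PosDef) (hW : W.PosDef)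
    {κ : ℝ} (h : Real.log S.det + (S⁻¹ * W).trace - (Real.log W.det + Fintype.card n) ≤ κ)
    (x : n → ℝ) : |x ⬝ᵥ (W - S) *ᵥ x| ≤ √κ * (2 + √κ) * (x ⬝ᵥ S *ᵥ x) := by
  obtain ⟨B, N, hN, htr, hdet, hSB, hWB⟩ := exists_whitening hS hW
  have := abs_quadForm_sub_le_of_trace_sub_log_det_le hN (κ := κ)
    (by rw [htr, hdet]; linarith) (B *ᵥ x)
  have hS' : x ⬝ᵥ S *ᵥ x = B *ᵥ x ⬝ᵥ B *ᵥ x := by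
    rw [hSB, ← Matrix.mulVec_mulVec, Matrix.dotProduct_mulVec x, Matrix.vecMul_transpose]
  have hW' : x ⬝ᵥ W *ᵥ x = B *ᵥ x ⬝ᵥ N *ᵥ (B *ᵥ x) := by
    rw [hWB, Matrix.mul_assoc, ← Matrix.mulVec_mulVec, Matrix.dotProduct_mulVec x,
      Matrix.vecMul_transpose, ← Matrix.mulVec_mulVec]
  rwa [Matrix.sub_mulVec, dotProduct_sub, hS', hW']

/-- Polarization: a bound between quadratic forms bounds the entries. -/
theorem abs_apply_le_of_abs_quadForm_le {X Y : Matrix n n ℝ} (hX : X.IsHermitian)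
    (h : ∀ x, |x ⬝ᵥ X *ᵥ x| ≤ x ⬝ᵥ Y *ᵥ x) (i j : n) : |X i j| ≤ (Y i i + Y j j) / 2 := by
  have hXs : X j i = X i j := by simpa using hX.apply i j
  have h1 := h (Pi.single i 1 + Pi.single j 1)
  have h2 := h (Pi.single i 1 - Pi.single j 1)
  simp only [Matrix.mulVec_add, Matrix.mulVec_sub, dotProduct_add, add_dotProduct, dotProduct_sub,
    sub_dotProduct, Matrix.mulVec_single_one, single_one_dotProduct, Matrix.col_apply, hXs] at h1 h2
  rw [abs_le] at h1 h2 ⊢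
  constructor <;> linarith

theorem abs_apply_le_of_posSemidef {Q : Matrix n n ℝ} (hQ : Q.PosSemidef) (i j : n) :
    |Q i j| ≤ (Q i i + Q j j) / 2 :=
  abs_apply_le_of_abs_quadForm_le hQ.1
    (fun x => (abs_of_nonneg (by simpa using hQ.dotProduct_mulVec_nonneg x)).le) i j

/-- Diagonal entries of a positive semidefinite matrix dominate the others, so entrywise errors cost
only a multiple of the trace, with no bound on `Q` needed. -/
theorem abs_sum_mul_apply_le {Q : Matrix n n ℝ} (hQ : Q.PosSemidef) {E : n → n → ℝ} {e : ℝ}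
    (hE : ∀ i j, |E i j| ≤ e) :
    |∑ i, ∑ j, E i j * Q i j| ≤ e * Fintype.card n * Q.trace := by
  have h1 : ∀ i j, |E i j * Q i j| ≤ e * ((Q i i + Q j j) / 2) := fun i j => by
    rw [abs_mul]
    exact mul_le_mul (hE i j) (abs_apply_le_of_posSemidef hQ i j) (abs_nonneg _)
      ((abs_nonneg _).trans (hE i j))
  calc |∑ i, ∑ j, E i j * Q i j| ≤ ∑ i, ∑ j, |E i j * Q i j| :=
        (Finset.abs_sum_le_sum_abs _ _).trans
          (Finset.sum_le_sum fun i _ => Finset.abs_sum_le_sum_abs _ _)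
    _ ≤ ∑ i, ∑ j, e * ((Q i i + Q j j) / 2) :=
        Finset.sum_le_sum fun i _ => Finset.sum_le_sum fun j _ => h1 i j
    _ = e * Fintype.card n * Q.trace := by
        simp only [← Finset.mul_sum, ← Finset.sum_div, Finset.sum_add_distrib, Finset.sum_const,
          Finset.card_univ, nsmul_eq_mul, Matrix.trace, Matrix.diag_apply]
        ring

end Matrices

/-! ### Expected loss of a misspecified normal model -/

section GaussianLoss

variable {n : Type*} [Fintype n] [DecidableEq n]

/-- Second moment matrix of errors with independent components of variances `v`, shifted by `δ`. -/
def shiftedCov (v δ : n → ℝ) : Matrix n n ℝ :=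
  Matrix.diagonal v + Matrix.vecMulVec δ δ

/-- Twice the negative expected log-likelihood, up to a constant, of the normal model with
covariance matrix `S` whose mean is off by `δ`. -/
def gaussLoss (v δ : n → ℝ) (S : Matrix n n ℝ) : ℝ :=
  Real.log S.det + (S⁻¹ * shiftedCov v δ).trace

/-- Squared Mahalanobis norm of `δ` for the covariance matrix `diagonal v`. -/
def mahalanobisSq (v δ : n → ℝ) : ℝ :=
  ∑ i, δ i ^ 2 / v i

theorem mahalanobisSq_nonneg {n : Type*} [Fintype n] {v : n → ℝ} (hv : ∀ i, 0 < v i)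
    (δ : n → ℝ) : 0 ≤ mahalanobisSq v δ :=
  Finset.sum_nonneg fun i _ => div_nonneg (sq_nonneg _) (hv i).le

theorem trace_mul_shiftedCov (v δ : n → ℝ) (Q : Matrix n n ℝ) :
    (Q * shiftedCov v δ).trace = ∑ i, v i * Q i i + δ ⬝ᵥ Q *ᵥ δ := by
  rw [shiftedCov, Matrix.mul_add, Matrix.trace_add]
  congr 1
  · simp [Matrix.trace, Matrix.mul_diagonal, mul_comm]
  · rw [Matrix.mul_vecMulVec, Matrix.trace_vecMulVec, dotProduct_comm]

theorem posDef_shiftedCov {v : n → ℝ} (hv : ∀ i, 0 < v i) (δ : n → ℝ) :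
    (shiftedCov v δ).PosDef := by
  have h : (Matrix.vecMulVec δ δ).PosSemidef := by
    simpa using Matrix.posSemidef_vecMulVec_self_star δ
  exact (Matrix.posDef_diagonal_iff.2 hv).add_posSemidef h

/-- Matrix determinant lemma for a rank-one update. -/
theorem det_shiftedCov {v : n → ℝ} (hv : ∀ i, 0 < v i) (δ : n → ℝ) :
    (shiftedCov v δ).det = (∏ i, v i) * (1 + mahalanobisSq v δ) := by
  have hu : IsUnit (Matrix.diagonal v).det := by
    rw [Matrix.det_diagonal]
    exact (Finset.prod_pos fun i _ => hv i).ne'.isUnit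
  have hinv : (Matrix.diagonal v)⁻¹ = Matrix.diagonal (fun i => (v i)⁻¹) := by
    refine Matrix.inv_eq_left_inv ?_
    rw [Matrix.diagonal_mul_diagonal, ← Matrix.diagonal_one]
    congr 1
    ext i
    exact inv_mul_cancel₀ (hv i).ne'
  rw [shiftedCov, Matrix.vecMulVec_eq Unit, Matrix.det_add_replicateCol_mul_replicateRow hu,
    Matrix.det_diagonal, hinv, Matrix.det_unique]
  congr 1
  rw [Matrix.add_apply, Matrix.one_apply_eq, Matrix.mul_apply]
  simp only [Matrix.mul_diagonal, Matrix.replicateRow_apply, Matrix.replicateCol_apply,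
    mahalanobisSq]
  congr 1
  exact Finset.sum_congr rfl fun i _ => by ring

theorem log_det_shiftedCov {v : n → ℝ} (hv : ∀ i, 0 < v i) (δ : n → ℝ) :
    Real.log (shiftedCov v δ).det =
      Real.log (∏ i, v i) + Real.log (1 + mahalanobisSq v δ) := by
  rw [det_shiftedCov hv, Real.log_mul (Finset.prod_pos fun i _ => hv i).ne']
  exact (add_pos_of_pos_of_nonneg one_pos (mahalanobisSq_nonneg hv δ)).ne'

theorem trace_inv_mul_shiftedCov_nonneg {v : n → ℝ} (hv : ∀ i, 0 < v i) (δ : n → ℝ)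
    {S : Matrix n n ℝ} (hS : S.PosDef) : 0 ≤ (S⁻¹ * shiftedCov v δ).trace := by
  rw [trace_mul_shiftedCov]
  refine add_nonneg (Finset.sum_nonneg fun i _ => mul_nonneg (hv i).le ?_) ?_
  · exact hS.inv.posSemidef.diag_nonneg
  · simpa using hS.inv.posSemidef.dotProduct_mulVec_nonneg δ

theorem trace_inv_shiftedCov_mul_self {v : n → ℝ} (hv : ∀ i, 0 < v i) (δ : n → ℝ) :
    ((shiftedCov v δ)⁻¹ * shiftedCov v δ).trace = Fintype.card n := by
  rw [Matrix.nonsing_inv_mul _ (posDef_shiftedCov hv δ).det_pos.ne'.isUnit, Matrix.trace_one]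

theorem gaussLoss_shiftedCov {v : n → ℝ} (hv : ∀ i, 0 < v i) (δ : n → ℝ) :
    gaussLoss v δ (shiftedCov v δ) = Real.log (shiftedCov v δ).det + Fintype.card n := by
  rw [gaussLoss, trace_inv_shiftedCov_mul_self hv]

/-- Minimize over `S` first (Stein loss); what remains is `log (1 + mahalanobisSq v δ)` plus a
constant, which is monotone. -/
theorem gaussLoss_shiftedCov_le {v : n → ℝ} (hv : ∀ i, 0 < v i) {δ δ₀ : n → ℝ}
    (h : mahalanobisSq v δ₀ ≤ mahalanobisSq v δ) {S : Matrix n n ℝ} (hS : S.PosDef) :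
    gaussLoss v δ₀ (shiftedCov v δ₀) ≤ gaussLoss v δ S := by
  have h1 := steinLoss_nonneg hS (posDef_shiftedCov hv δ)
  have h2 : Real.log (1 + mahalanobisSq v δ₀) ≤ Real.log (1 + mahalanobisSq v δ) :=
    Real.log_le_log (by linarith [mahalanobisSq_nonneg hv δ₀]) (by linarith)
  rw [gaussLoss_shiftedCov hv, log_det_shiftedCov hv]
  rw [log_det_shiftedCov hv] at h1
  rw [gaussLoss]
  linarith

/-- Doubling the covariance matrix in the minimality of `gaussLoss` gives a lower bound in which
only half of the quadratic term is used. -/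
theorem le_log_det_add_half_trace {v : n → ℝ} (hv : ∀ i, 0 < v i) {δ δ₀ : n → ℝ}
    (h : mahalanobisSq v δ₀ ≤ mahalanobisSq v δ) {S : Matrix n n ℝ} (hS : S.PosDef) :
    gaussLoss v δ₀ (shiftedCov v δ₀) - Fintype.card n * Real.log 2 ≤
      Real.log S.det + (S⁻¹ * shiftedCov v δ).trace / 2 := by
  have h2S : ((2 : ℝ) • S).PosDef := hS.smul two_pos
  have h1 := gaussLoss_shiftedCov_le hv h h2S
  have hinv : ((2 : ℝ) • S)⁻¹ = (2 : ℝ)⁻¹ • S⁻¹ := by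
    refine Matrix.inv_eq_left_inv ?_
    rw [Matrix.smul_mul, Matrix.mul_smul, smul_smul, Matrix.nonsing_inv_mul _ hS.det_pos.ne'.isUnit]
    norm_num
  rw [gaussLoss.eq_def v δ, hinv, Matrix.smul_mul, Matrix.trace_smul, Matrix.det_smul,
    Real.log_mul (by positivity) hS.det_pos.ne', Real.log_pow, smul_eq_mul] at h1
  linarith

/-- The minimum of `gaussLoss` is well separated. -/
theorem tendsto_of_tendsto_gaussLoss {X : Type*} {l : Filter X} {v : n → ℝ} (hv : ∀ i, 0 < v i)
    {δ : X → n → ℝ} {S : X → Matrix n n ℝ} {δ₀ : n → ℝ} (hS : ∀ᶠ x in l, (S x).PosDef)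
    (hpyth : ∀ᶠ x in l,
      mahalanobisSq v (δ x) = mahalanobisSq v δ₀ + mahalanobisSq v (δ x - δ₀))
    (hG : Tendsto (fun x => gaussLoss v (δ x) (S x)) l (𝓝 (gaussLoss v δ₀ (shiftedCov v δ₀)))) :
    Tendsto δ l (𝓝 δ₀) ∧ Tendsto S l (𝓝 (shiftedCov v δ₀)) := by
  set s₀ := mahalanobisSq v δ₀ with hs₀
  have hs₀' : 0 ≤ s₀ := mahalanobisSq_nonneg hv δ₀
  -- The excess loss splits into `κ`, due to the wrong covariance given `δ`, and `ρ`, due to the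
  -- wrong deviation. Both are eventually nonnegative, so both vanish in the limit.
  set κ : X → ℝ := fun x => gaussLoss v (δ x) (S x) -
    (Real.log (shiftedCov v (δ x)).det + Fintype.card n) with hκ
  set ρ : X → ℝ := fun x => Real.log (1 + mahalanobisSq v (δ x)) - Real.log (1 + s₀) with hρ
  have hsum : ∀ x, κ x + ρ x = gaussLoss v (δ x) (S x) - gaussLoss v δ₀ (shiftedCov v δ₀) :=
    fun x => by
      simp only [hκ, hρ]
      rw [gaussLoss_shiftedCov hv, log_det_shiftedCov hv, log_det_shiftedCov hv]
      ring
  have hsum0 : Tendsto (fun x => κ x + ρ x) l (𝓝 0) := by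
    simp only [hsum]
    simpa using hG.sub_const (gaussLoss v δ₀ (shiftedCov v δ₀))
  have hκ0 : ∀ᶠ x in l, 0 ≤ κ x := hS.mono fun x hx => steinLoss_nonneg hx (posDef_shiftedCov hv _)
  have hρ0 : ∀ᶠ x in l, 0 ≤ ρ x := hpyth.mono fun x hx => by
    refine sub_nonneg.2 (Real.log_le_log (by linarith) ?_)
    linarith [mahalanobisSq_nonneg hv (δ x - δ₀)]
  have hκt : Tendsto κ l (𝓝 0) := tendsto_of_tendsto_of_tendsto_of_le_of_le' tendsto_const_nhds
    hsum0 hκ0 (hρ0.mono fun x hx => by linarith)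
  have hρt : Tendsto ρ l (𝓝 0) := tendsto_of_tendsto_of_tendsto_of_le_of_le' tendsto_const_nhds
    hsum0 hρ0 (hκ0.mono fun x hx => by linarith)
  have hst : Tendsto (fun x => mahalanobisSq v (δ x - δ₀)) l (𝓝 0) := by
    have h1 : Tendsto (fun x => (1 + s₀) * Real.exp (ρ x) - (1 + s₀)) l (𝓝 0) := by
      have := ((Real.continuous_exp.tendsto 0).comp hρt).const_mul (1 + s₀) |>.sub_const (1 + s₀)
      simpa using this
    refine h1.congr' (hpyth.mono fun x hx => ?_)
    have h2 := mahalanobisSq_nonneg hv (δ x - δ₀)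
    simp only [hρ]
    rw [Real.exp_sub, Real.exp_log (by linarith), Real.exp_log (by linarith), hx]
    field_simp
    ring
  have hδ : Tendsto δ l (𝓝 δ₀) := by
    rw [tendsto_pi_nhds]
    intro i
    rw [tendsto_iff_norm_sub_tendsto_zero]
    have h1 : Tendsto (fun x => √(v i * mahalanobisSq v (δ x - δ₀))) l (𝓝 0) := by
      have := (hst.const_mul (v i)).sqrt
      simpa using this
    refine squeeze_zero (fun x => norm_nonneg _) (fun x => ?_) h1
    refine Real.abs_le_sqrt ?_
    have h2 : (δ x - δ₀) i ^ 2 / v i ≤ mahalanobisSq v (δ x - δ₀) :=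
      Finset.single_le_sum (f := fun i => (δ x - δ₀) i ^ 2 / v i)
        (fun i _ => div_nonneg (sq_nonneg _) (hv i).le) (Finset.mem_univ i)
    rw [div_le_iff₀ (hv i)] at h2
    rw [mul_comm]
    exact h2
  refine ⟨hδ, ?_⟩
  set τ : X → ℝ := fun x => √(κ x) * (2 + √(κ x)) with hτ
  have hτt : Tendsto τ l (𝓝 0) := by
    have h1 : Tendsto (fun x => √(κ x)) l (𝓝 0) := by simpa using hκt.sqrt
    simpa using h1.mul (h1.const_add 2)
  have hW : Tendsto (fun x => shiftedCov v (δ x)) l (𝓝 (shiftedCov v δ₀)) := by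
    have hc : Continuous (fun d : n → ℝ => shiftedCov v d) :=
      continuous_const.add (continuous_id.matrix_vecMulVec continuous_id)
    exact (hc.tendsto δ₀).comp hδ
  have hWij : ∀ i j, Tendsto (fun x => shiftedCov v (δ x) i j) l (𝓝 (shiftedCov v δ₀ i j)) :=
    fun i j => tendsto_pi_nhds.1 (tendsto_pi_nhds.1 hW i) j
  have hent : ∀ᶠ x in l, ∀ i j, |shiftedCov v (δ x) i j - S x i j| ≤
      τ x * ((S x i i + S x j j) / 2) := hS.mono fun x hx i j => by
    have h1 := abs_apply_le_of_abs_quadForm_le (X := shiftedCov v (δ x) - S x) (Y := τ x • S x)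
      ((posDef_shiftedCov hv _).1.sub hx.1) (fun y => by
        have := abs_quadForm_sub_le_of_steinLoss_le hx (posDef_shiftedCov hv (δ x)) (κ := κ x)
          le_rfl y
        rwa [Matrix.smul_mulVec, dotProduct_smul, smul_eq_mul]) i j
    simp only [Matrix.sub_apply, Matrix.smul_apply, smul_eq_mul] at h1
    linarith
  -- The entry bound is relative to `S`, which is not yet known to be bounded; `τ < 1/2` turns it
  -- into `S k k ≤ 2 * shiftedCov k k`.
  have hτ2 : ∀ᶠ x in l, τ x < 1 / 2 := hτt.eventually_lt_const (by norm_num)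
  have hfin : ∀ i j, Tendsto (fun x => shiftedCov v (δ x) i j - S x i j) l (𝓝 0) := fun i j => by
    have h1 : Tendsto (fun x => τ x * (shiftedCov v (δ x) i i + shiftedCov v (δ x) j j)) l (𝓝 0) := by
      simpa using hτt.mul ((hWij i i).add (hWij j j))
    refine squeeze_zero_norm' ?_ h1
    filter_upwards [hent, hτ2, hS] with x hx hx2 hSx
    have hτ0 : 0 ≤ τ x := by positivity
    have hdiag : ∀ k, S x k k ≤ 2 * shiftedCov v (δ x) k k := fun k => by
      have h2 := (abs_le.1 (hx k k)).1
      have h3 : 0 ≤ S x k k := hSx.posSemidef.diag_nonneg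
      nlinarith
    refine (hx i j).trans (mul_le_mul_of_nonneg_left ?_ hτ0)
    linarith [hdiag i, hdiag j]
  refine tendsto_pi_nhds.2 fun i => tendsto_pi_nhds.2 fun j => ?_
  simpa using (hWij i j).sub (hfin i j)

/-- If first and second sample moments of the errors converge, the average quadratic form is
uniformly close, in relative terms, to its expectation. -/
theorem eventually_abs_avg_quadForm_sub_le {v : n → ℝ} (hv : ∀ i, 0 < v i) {e : ℕ → n → ℝ}
    (h1 : ∀ i, Tendsto (fun t : ℕ => (∑ z ∈ Finset.range t, e z i) / t) atTop (𝓝 0))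
    (h2 : ∀ i j, Tendsto (fun t : ℕ => (∑ z ∈ Finset.range t, e z i * e z j) / t) atTop
      (𝓝 (Matrix.diagonal v i j))) {η : ℝ} (hη : 0 < η) :
    ∀ᶠ t : ℕ in atTop, ∀ Q : Matrix n n ℝ, Q.PosSemidef → ∀ δ : n → ℝ,
      |(∑ z ∈ Finset.range t, (e z + δ) ⬝ᵥ Q *ᵥ (e z + δ)) / t - (Q * shiftedCov v δ).trace| ≤
        η * (Q * shiftedCov v δ).trace := by
  obtain ⟨m, hm, hmv⟩ : ∃ m : ℝ, 0 < m ∧ ∀ i, m ≤ v i := by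
    rcases isEmpty_or_nonempty n with hn | hn
    · exact ⟨1, one_pos, fun i => hn.elim i⟩
    · obtain ⟨i, hi⟩ := Finite.exists_min v
      exact ⟨v i, hv i, hi⟩
  -- The `+ 1` covers an empty index type. The tolerances satisfy `e₁ + e₂ / η = η m / N`, so second
  -- and first moments each use half of the budget.
  set N : ℝ := Fintype.card n + 1 with hN
  have hNpos : 0 < N := by positivity
  set e₁ : ℝ := η * m / (2 * N) with he₁
  set e₂ : ℝ := η ^ 2 * m / (2 * N) with he₂
  have hC : ∀ᶠ t : ℕ in atTop, ∀ i j,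
      |(∑ z ∈ Finset.range t, e z i * e z j) / t - Matrix.diagonal v i j| ≤ e₁ := by
    refine eventually_all.2 fun i => eventually_all.2 fun j => ?_
    have := (tendsto_iff_norm_sub_tendsto_zero.1 (h2 i j)).eventually_lt_const
      (show (0 : ℝ) < e₁ by positivity)
    exact this.mono fun t ht => ht.le
  have hb : ∀ᶠ t : ℕ in atTop, ∀ i j,
      |((∑ z ∈ Finset.range t, e z i) / t) * ((∑ z ∈ Finset.range t, e z j) / t)| ≤ e₂ := by
    refine eventually_all.2 fun i => eventually_all.2 fun j => ?_
    have h3 : Tendsto (fun t : ℕ => |((∑ z ∈ Finset.range t, e z i) / t) *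
        ((∑ z ∈ Finset.range t, e z j) / t)|) atTop (𝓝 0) := by
      simpa using ((h1 i).mul (h1 j)).abs
    exact (h3.eventually_lt_const (show (0 : ℝ) < e₂ by positivity)).mono fun t ht => ht.le
  filter_upwards [hC, hb, eventually_gt_atTop 0] with t hCt hbt ht Q hQ δ
  have ht' : (t : ℝ) ≠ 0 := by exact_mod_cast ht.ne'
  set b : n → ℝ := fun i => (∑ z ∈ Finset.range t, e z i) / t with hbdef
  have hsymm : ∀ x y : n → ℝ, x ⬝ᵥ Q *ᵥ y = y ⬝ᵥ Q *ᵥ x := fun x y => by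
    have hQt : Qᵀ = Q := by simpa using hQ.1.eq
    rw [dotProduct_comm, ← Matrix.vecMul_transpose, hQt, ← Matrix.dotProduct_mulVec]
  have hbil : ∀ x y : n → ℝ, x ⬝ᵥ Q *ᵥ y = ∑ i, ∑ j, x i * y j * Q i j := fun x y => by
    simp only [dotProduct, Matrix.mulVec, Finset.mul_sum]
    exact Finset.sum_congr rfl fun i _ => Finset.sum_congr rfl fun j _ => by ring
  have havg : (∑ z ∈ Finset.range t, (e z + δ) ⬝ᵥ Q *ᵥ (e z + δ)) / t =
      (∑ i, ∑ j, ((∑ z ∈ Finset.range t, e z i * e z j) / t) * Q i j) + 2 * (b ⬝ᵥ Q *ᵥ δ) +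
        δ ⬝ᵥ Q *ᵥ δ := by
    have hA : ∑ i, ∑ j, ((∑ z ∈ Finset.range t, e z i * e z j) / t) * Q i j =
        (∑ z ∈ Finset.range t, e z ⬝ᵥ Q *ᵥ e z) / t := by
      simp only [hbil, Finset.sum_div, Finset.sum_mul]
      rw [Finset.sum_comm]
      conv_rhs => rw [Finset.sum_comm]
      rw [Finset.sum_comm]
      refine Finset.sum_congr rfl fun i _ => ?_
      rw [Finset.sum_comm]
      exact Finset.sum_congr rfl fun z _ => Finset.sum_congr rfl fun j _ => by ring
    have hB : b ⬝ᵥ Q *ᵥ δ = (∑ z ∈ Finset.range t, e z ⬝ᵥ Q *ᵥ δ) / t := by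
      rw [← sum_dotProduct, eq_div_iff ht', mul_comm, ← smul_eq_mul, ← smul_dotProduct]
      congr 1
      ext i
      simp [hbdef, mul_div_cancel₀ _ ht', Finset.sum_apply]
    have hz : ∀ z, (e z + δ) ⬝ᵥ Q *ᵥ (e z + δ) =
        e z ⬝ᵥ Q *ᵥ e z + 2 * (e z ⬝ᵥ Q *ᵥ δ) + δ ⬝ᵥ Q *ᵥ δ := fun z => by
      rw [Matrix.mulVec_add, dotProduct_add, add_dotProduct, add_dotProduct, hsymm δ (e z)]
      ring
    simp only [hz, Finset.sum_add_distrib, ← Finset.mul_sum, Finset.sum_const, Finset.card_range,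
      nsmul_eq_mul]
    rw [hA, hB]
    field_simp
  have hdiff : (∑ z ∈ Finset.range t, (e z + δ) ⬝ᵥ Q *ᵥ (e z + δ)) / t -
      (Q * shiftedCov v δ).trace =
      (∑ i, ∑ j, ((∑ z ∈ Finset.range t, e z i * e z j) / t - Matrix.diagonal v i j) * Q i j) +
        2 * (b ⬝ᵥ Q *ᵥ δ) := by
    have hD : ∑ i, ∑ j, Matrix.diagonal v i j * Q i j = ∑ i, v i * Q i i := by
      simp [Matrix.diagonal_apply]
    simp only [havg, trace_mul_shiftedCov, sub_mul, Finset.sum_sub_distrib, hD]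
    ring
  have hAB : |∑ i, ∑ j, ((∑ z ∈ Finset.range t, e z i * e z j) / t - Matrix.diagonal v i j) *
      Q i j| ≤ e₁ * Fintype.card n * Q.trace := abs_sum_mul_apply_le hQ hCt
  have hbb : b ⬝ᵥ Q *ᵥ b ≤ e₂ * Fintype.card n * Q.trace := by
    rw [hbil]
    exact (le_abs_self _).trans (abs_sum_mul_apply_le hQ hbt)
  -- With weight `η` the cross term costs exactly the allowed `η` share of the `δ` form, plus a form
  -- in the mean error `b` that the trace absorbs.
  have hcross := two_mul_abs_dotProduct_mulVec_le hQ hη b δ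
  have hQtr : 0 ≤ Q.trace := Finset.sum_nonneg fun i _ => hQ.diag_nonneg
  have hmtr : m * Q.trace ≤ ∑ i, v i * Q i i := by
    rw [Matrix.trace, Finset.mul_sum]
    exact Finset.sum_le_sum fun i _ => mul_le_mul_of_nonneg_right (hmv i) hQ.diag_nonneg
  have hcoef : e₁ * Fintype.card n * Q.trace + η⁻¹ * (e₂ * Fintype.card n * Q.trace) ≤
      η * (m * Q.trace) := by
    have h3 : e₁ * Fintype.card n * Q.trace + η⁻¹ * (e₂ * Fintype.card n * Q.trace) =
        η * (m * Q.trace) * (Fintype.card n / N) := by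
      rw [he₁, he₂]
      field_simp
      ring
    rw [h3]
    refine mul_le_of_le_one_right (by positivity) ?_
    rw [div_le_one hNpos]
    linarith
  rw [hdiff, trace_mul_shiftedCov]
  have h5 : |2 * (b ⬝ᵥ Q *ᵥ δ)| = 2 * |b ⬝ᵥ Q *ᵥ δ| := by rw [abs_mul, abs_two]
  have h6 := mul_le_mul_of_nonneg_left hbb (inv_pos.2 hη).le
  have h7 := mul_le_mul_of_nonneg_left hmtr hη.le
  refine (abs_add_le _ _).trans ?_
  rw [h5, mul_add]
  linarith

end GaussianLoss

/-! ### Posterior concentration from a loss gap -/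

section Concentration

variable {X : Type*} [MeasurableSpace X]

/-- The share of the integral of `L` that falls on `B`. -/
def likelihoodShare (μ : Measure X) (L : X → ℝ) (B : Set X) : ℝ≥0∞ :=
  (∫⁻ x in B, ENNReal.ofReal (L x) ∂μ) / ∫⁻ x, ENNReal.ofReal (L x) ∂μ

theorem likelihoodShare_le_div {μ : Measure X} [IsProbabilityMeasure μ] {L : X → ℝ}
    {B N : Set X} (hB : MeasurableSet B) (hN : MeasurableSet N) {lo hi : ℝ}
    (hNL : ∀ᵐ x ∂μ, x ∈ N → lo ≤ L x) (hBL : ∀ᵐ x ∂μ, x ∈ B → L x ≤ hi) :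
    likelihoodShare μ L B ≤ ENNReal.ofReal hi / (ENNReal.ofReal lo * μ N) := by
  refine ENNReal.div_le_div ?_ ?_
  · calc ∫⁻ x in B, ENNReal.ofReal (L x) ∂μ ≤ ∫⁻ _ in B, ENNReal.ofReal hi ∂μ :=
          lintegral_mono_ae (((ae_restrict_iff' hB).2 hBL).mono fun x hx =>
            ENNReal.ofReal_le_ofReal hx)
      _ = ENNReal.ofReal hi * μ B := setLIntegral_const _ _
      _ ≤ ENNReal.ofReal hi := mul_le_of_le_one_right' prob_le_one
  · calc ENNReal.ofReal lo * μ N = ∫⁻ _ in N, ENNReal.ofReal lo ∂μ := (setLIntegral_const _ _).symm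
      _ ≤ ∫⁻ x in N, ENNReal.ofReal (L x) ∂μ :=
          lintegral_mono_ae (((ae_restrict_iff' hN).2 hNL).mono fun x hx =>
            ENNReal.ofReal_le_ofReal hx)
      _ ≤ ∫⁻ x, ENNReal.ofReal (L x) ∂μ := setLIntegral_le_lintegral _ _

/-- The bound `hi` serves only to make the total integral finite. -/
theorem likelihoodShare_eq_one_sub {μ : Measure X} [IsProbabilityMeasure μ] {L : X → ℝ}
    {B : Set X} (hB : MeasurableSet B) (h0 : ∫⁻ x, ENNReal.ofReal (L x) ∂μ ≠ 0) {hi : ℝ}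
    (hL : ∀ᵐ x ∂μ, L x ≤ hi) : likelihoodShare μ L B = 1 - likelihoodShare μ L Bᶜ := by
  have htop : ∫⁻ x, ENNReal.ofReal (L x) ∂μ ≠ ∞ := by
    refine ne_top_of_le_ne_top (ENNReal.ofReal_ne_top (r := hi)) ?_
    calc ∫⁻ x, ENNReal.ofReal (L x) ∂μ ≤ ∫⁻ _, ENNReal.ofReal hi ∂μ :=
          lintegral_mono_ae (hL.mono fun x hx => ENNReal.ofReal_le_ofReal hx)
      _ = ENNReal.ofReal hi := by simp
  have hsum : likelihoodShare μ L B + likelihoodShare μ L Bᶜ = 1 := by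
    rw [likelihoodShare, likelihoodShare, ← ENNReal.add_div, lintegral_add_compl _ hB,
      ENNReal.div_self h0 htop]
  refine ENNReal.eq_sub_of_add_eq ?_ hsum
  exact ne_top_of_le_ne_top ENNReal.one_ne_top (hsum ▸ le_add_self)

/-- If the average loss is eventually at most `a` on a set of positive prior probability and at
least `b > a` off `B`, then the posterior probability of `B` tends to one. -/
theorem tendsto_likelihoodShare_one {μ : Measure X} [IsProbabilityMeasure μ] {L : ℕ → X → ℝ}
    {f : ℕ → X → ℝ} {Θ : Set X} (hΘ : ∀ᵐ x ∂μ, x ∈ Θ)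
    (hL : ∀ t : ℕ, 0 < t → ∀ x ∈ Θ, L t x = Real.exp (-(t / 2) * f t x))
    {B N : Set X} (hB : MeasurableSet B) (hN : MeasurableSet N) (hNpos : 0 < μ N) {a b m : ℝ}
    (hab : a < b) (hm : ∀ᶠ t in atTop, ∀ x ∈ Θ, m ≤ f t x)
    (ha : ∀ᶠ t in atTop, ∀ x ∈ Θ, x ∈ N → f t x ≤ a)
    (hb : ∀ᶠ t in atTop, ∀ x ∈ Θ, x ∉ B → b ≤ f t x) :
    Tendsto (fun t => likelihoodShare μ (L t) B) atTop (𝓝 1) := by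
  have hLlo : ∀ᶠ t : ℕ in atTop, ∀ᵐ x ∂μ, x ∈ N → Real.exp (-(t / 2) * a) ≤ L t x := by
    filter_upwards [ha, eventually_gt_atTop 0] with t ht ht0
    filter_upwards [hΘ] with x hx hxN
    rw [hL t ht0 x hx]
    exact Real.exp_le_exp.2
      (mul_le_mul_of_nonpos_left (ht x hx hxN) (neg_nonpos.2 (by positivity)))
  have hLhi : ∀ᶠ t : ℕ in atTop, ∀ᵐ x ∂μ, x ∈ Bᶜ → L t x ≤ Real.exp (-(t / 2) * b) := by
    filter_upwards [hb, eventually_gt_atTop 0] with t ht ht0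
    filter_upwards [hΘ] with x hx hxB
    rw [hL t ht0 x hx]
    exact Real.exp_le_exp.2
      (mul_le_mul_of_nonpos_left (ht x hx hxB) (neg_nonpos.2 (by positivity)))
  have hLm : ∀ᶠ t : ℕ in atTop, ∀ᵐ x ∂μ, L t x ≤ Real.exp (-(t / 2) * m) := by
    filter_upwards [hm, eventually_gt_atTop 0] with t ht ht0
    filter_upwards [hΘ] with x hx
    rw [hL t ht0 x hx]
    exact Real.exp_le_exp.2
      (mul_le_mul_of_nonpos_left (ht x hx) (neg_nonpos.2 (by positivity)))
  have hcompl : Tendsto (fun t => likelihoodShare μ (L t) Bᶜ) atTop (𝓝 0) := by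
    have hexp : Tendsto (fun t : ℕ => Real.exp (-(t / 2) * (b - a))) atTop (𝓝 0) := by
      refine Real.tendsto_exp_atBot.comp ?_
      have h1 : Tendsto (fun t : ℕ => (t : ℝ) * ((b - a) / 2)) atTop atTop :=
        tendsto_natCast_atTop_atTop.atTop_mul_const (by linarith)
      refine (tendsto_neg_atTop_atBot.comp h1).congr fun t => ?_
      simp only [Function.comp]
      ring
    have hlim : Tendsto (fun t : ℕ => ENNReal.ofReal (Real.exp (-(t / 2) * (b - a))) / μ N)
        atTop (𝓝 0) := by
      have h2 := ENNReal.Tendsto.div_const (b := μ N) (ENNReal.tendsto_ofReal hexp)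
        (Or.inr hNpos.ne')
      simpa using h2
    refine tendsto_of_tendsto_of_tendsto_of_le_of_le' tendsto_const_nhds hlim
      (Eventually.of_forall fun _ => zero_le) ?_
    filter_upwards [hLlo, hLhi] with t h1 h2
    refine (likelihoodShare_le_div hB.compl hN h1 h2).trans_eq ?_
    have h3 : Real.exp (-(t / 2) * b) =
        Real.exp (-(t / 2) * a) * Real.exp (-(t / 2) * (b - a)) := by
      rw [← Real.exp_add]
      ring_nf
    rw [h3, ENNReal.ofReal_mul (Real.exp_pos _).le]
    exact ENNReal.mul_div_mul_left _ _ (by simpa using Real.exp_pos _) ENNReal.ofReal_ne_top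
  have hone : Tendsto (fun t => 1 - likelihoodShare μ (L t) Bᶜ) atTop (𝓝 1) := by
    simpa using ENNReal.Tendsto.sub tendsto_const_nhds hcompl (Or.inl ENNReal.one_ne_top)
  refine hone.congr' ?_
  filter_upwards [hLlo, hLm] with t h1 h2
  refine (likelihoodShare_eq_one_sub hB (fun h0 => ?_) h2).symm
  have h3 : ENNReal.ofReal (Real.exp (-(t / 2) * a)) * μ N ≤ ∫⁻ x, ENNReal.ofReal (L t x) ∂μ :=
    calc ENNReal.ofReal (Real.exp (-(t / 2) * a)) * μ N
        = ∫⁻ _ in N, ENNReal.ofReal (Real.exp (-(t / 2) * a)) ∂μ := (setLIntegral_const _ _).symm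
      _ ≤ ∫⁻ x in N, ENNReal.ofReal (L t x) ∂μ :=
          lintegral_mono_ae (((ae_restrict_iff' hN).2 h1).mono fun x hx =>
            ENNReal.ofReal_le_ofReal hx)
      _ ≤ ∫⁻ x, ENNReal.ofReal (L t x) ∂μ := setLIntegral_le_lintegral _ _
  rw [h0, nonpos_iff_eq_zero, mul_eq_zero] at h3
  rcases h3 with h3 | h3
  · exact absurd h3 (by simpa using Real.exp_pos _)
  · exact hNpos.ne' h3

theorem likelihoodShare_add_le_one {μ : Measure X} {L : X → ℝ} {U V : Set X}
    (hV : MeasurableSet V) (hUV : Disjoint U V) :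
    likelihoodShare μ L U + likelihoodShare μ L V ≤ 1 := by
  rw [likelihoodShare, likelihoodShare, ← ENNReal.add_div, ← lintegral_union hV hUV]
  exact (ENNReal.div_le_div_right (setLIntegral_le_lintegral _ _) _).trans ENNReal.div_self_le_one

/-- Disjoint neighbourhoods of two such points would have total probability tending to `2`. -/
theorem ConcentratesOn.eq [TopologicalSpace X] [T2Space X] [OpensMeasurableSpace X]
    {μ : Measure X} {L : ℕ → X → ℝ} {x y : X}
    (hx : ConcentratesOn (fun t => likelihoodShare μ (L t)) x)
    (hy : ConcentratesOn (fun t => likelihoodShare μ (L t)) y) : y = x := by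
  by_contra hne
  obtain ⟨U, V, hU, hV, hyU, hxV, hUV⟩ := t2_separation hne
  have h1 := (hy U hU hyU).add (hx V hV hxV)
  have h2 : (1 + 1 : ℝ≥0∞) ≤ 1 := le_of_tendsto' h1 fun t =>
    likelihoodShare_add_le_one hV.measurableSet hUV
  norm_num at h2

end Concentration

/-! ### Strong laws for first and second moments of the errors -/

section Errors

variable {D Ω : Type*} [MeasurableSpace Ω] {P : Measure Ω}
  {ε : ℕ → D → Ω → ℝ} {v : D → ℝ≥0}

theorem ae_tendsto_avg_error (hlaw : ∀ t d, HasLaw (ε t d) (gaussianReal 0 (v d)) P)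
    (hindep : iIndepFun (fun p : ℕ × D => ε p.1 p.2) P) (d : D) :
    ∀ᵐ ω ∂P, Tendsto (fun t : ℕ => (∑ z ∈ Finset.range t, ε z d ω) / t) atTop (𝓝 0) := by
  have hint : Integrable (ε 0 d) P := by
    have h1 : MemLp id 1 (P.map (ε 0 d)) := by
      rw [(hlaw 0 d).map_eq]
      exact memLp_id_gaussianReal' 1 ENNReal.one_ne_top
    exact memLp_one_iff_integrable.1 (h1.comp_of_map (hlaw 0 d).aemeasurable)
  have h := strong_law_ae_real (fun t => ε t d) hint
    (fun s t hst => hindep.indepFun (i := (s, d)) (j := (t, d)) (by simpa using hst))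
    (fun t => ⟨(hlaw t d).aemeasurable, (hlaw 0 d).aemeasurable,
      (hlaw t d).map_eq.trans (hlaw 0 d).map_eq.symm⟩)
  rwa [(hlaw 0 d).integral_eq, integral_id_gaussianReal] at h

theorem ae_tendsto_avg_error_mul_error [DecidableEq D] [IsProbabilityMeasure P]
    (hlaw : ∀ t d, HasLaw (ε t d) (gaussianReal 0 (v d)) P)
    (hindep : iIndepFun (fun p : ℕ × D => ε p.1 p.2) P) (d d' : D) :
    ∀ᵐ ω ∂P, Tendsto (fun t : ℕ => (∑ z ∈ Finset.range t, ε z d ω * ε z d' ω) / t) atTop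
      (𝓝 (Matrix.diagonal (fun d => (v d : ℝ)) d d')) := by
  have hL2 : ∀ d, MemLp (ε 0 d) 2 P := fun d => by
    have h1 : MemLp id 2 (P.map (ε 0 d)) := by
      rw [(hlaw 0 d).map_eq]
      exact memLp_id_gaussianReal' 2 (by simp)
    exact h1.comp_of_map (hlaw 0 d).aemeasurable
  have hident : ∀ t d, IdentDistrib (ε t d) (ε 0 d) P P := fun t d =>
    ⟨(hlaw t d).aemeasurable, (hlaw 0 d).aemeasurable,
      (hlaw t d).map_eq.trans (hlaw 0 d).map_eq.symm⟩
  have hmean : ∀ d, ∫ ω, ε 0 d ω ∂P = 0 := fun d => by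
    rw [(hlaw 0 d).integral_eq, integral_id_gaussianReal]
  have hmul : Measurable fun p : ℝ × ℝ => p.1 * p.2 := measurable_fst.mul measurable_snd
  have h := strong_law_ae_real (fun t ω => ε t d ω * ε t d' ω) ((hL2 d).integrable_mul (hL2 d'))
    (fun s t hst => by
      have hne : ∀ a b : D, ((s, a) : ℕ × D) ≠ (t, b) := fun a b hab => hst (congrArg Prod.fst hab)
      exact (hindep.indepFun_prodMk_prodMk₀ (fun p => (hlaw p.1 p.2).aemeasurable) (s, d) (s, d')
        (t, d) (t, d') (hne _ _) (hne _ _) (hne _ _) (hne _ _)).comp hmul hmul)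
    (fun t => by
      -- A pair with `d = d'` is not independent, so the joint law is treated separately on the
      -- diagonal.
      by_cases hdd : d = d'
      · subst hdd
        exact (hident t d).comp (u := fun x => x * x) (measurable_id.mul measurable_id)
      · have hne : ∀ t : ℕ, ((t, d) : ℕ × D) ≠ (t, d') := fun t hab =>
          hdd (congrArg Prod.snd hab)
        exact ((hident t d).prodMk (hident t d') (hindep.indepFun (hne t))
          (hindep.indepFun (hne 0))).comp hmul)
  have hval : ∫ ω, ε 0 d ω * ε 0 d' ω ∂P = Matrix.diagonal (fun d => (v d : ℝ)) d d' := by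
    by_cases hdd : d = d'
    · subst hdd
      have h1 := (hlaw 0 d).variance_eq
      rw [variance_of_integral_eq_zero (hlaw 0 d).aemeasurable (hmean d)] at h1
      rw [Matrix.diagonal_apply_eq]
      calc ∫ ω, ε 0 d ω * ε 0 d ω ∂P = ∫ ω, (ε 0 d ω) ^ 2 ∂P := by simp only [sq]
        _ = Var[id; gaussianReal 0 (v d)] := h1
        _ = v d := variance_id_gaussianReal
    · have hne : ((0, d) : ℕ × D) ≠ (0, d') := fun hab => hdd (congrArg Prod.snd hab)
      have h1 := (hindep.indepFun hne).integral_mul_eq_mul_integral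
        (hL2 d).aestronglyMeasurable (hL2 d').aestronglyMeasurable
      rw [Matrix.diagonal_apply_ne _ hdd]
      calc ∫ ω, ε 0 d ω * ε 0 d' ω ∂P = (∫ ω, ε 0 d ω ∂P) * ∫ ω, ε 0 d' ω ∂P := h1
        _ = 0 := by rw [hmean d, zero_mul]
  rwa [hval] at h

end Errors

/-! ### The signal model and its minimizer -/

section Model

variable {I K : ℕ} (c : Fin I → Fin K → ℝ) (A : Fin I → ℝ) (Θ : Fin K → ℝ)

/-- The error that parameter `x` makes about the mean of an observation. -/
def deviation (x : Param I K) : Obs I K → ℝ :=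
  meanObs c A Θ - meanObs c x.1 x.2.1

/-- The calibers and levels of discrimination for which the deviation is `δ`. -/
def shiftedParam (δ : Obs I K → ℝ) : (Fin I → ℝ) × (Fin K → ℝ) :=
  (fun j => A j - δ (Sum.inl j) + ∑ k, c j k * δ (Sum.inr k), fun k => Θ k - δ (Sum.inr k))

/-- Twice the negative average log-likelihood of the errors `e 0, …, e (t - 1)` under `x`, up to
a constant. -/
def avgLoss (e : ℕ → Obs I K → ℝ) (t : ℕ) (x : Param I K) : ℝ :=
  Real.log x.2.2.det + (∑ z ∈ Finset.range t,
    (e z + deviation c A Θ x) ⬝ᵥ x.2.2⁻¹ *ᵥ (e z + deviation c A Θ x)) / t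

theorem shiftedParam_deviation (x : Param I K) :
    shiftedParam c A Θ (deviation c A Θ x) = (x.1, x.2.1) := by
  refine Prod.ext (funext fun j => ?_) (funext fun k => ?_)
  · simp only [shiftedParam, deviation, meanObs, Pi.sub_apply, Sum.elim_inl, Sum.elim_inr, mul_sub,
      Finset.sum_sub_distrib]
    ring
  · simp [shiftedParam, deviation, meanObs]

theorem deviation_shiftedParam (δ : Obs I K → ℝ) (S : Matrix (Obs I K) (Obs I K) ℝ) :
    deviation c A Θ ((shiftedParam c A Θ δ).1, (shiftedParam c A Θ δ).2, S) = δ := by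
  ext (j | k)
  · simp only [shiftedParam, deviation, meanObs, Pi.sub_apply, Sum.elim_inl, mul_sub,
      Finset.sum_sub_distrib]
    ring
  · simp [shiftedParam, deviation, meanObs]

theorem continuous_deviation : Continuous (deviation c A Θ) := by
  refine continuous_pi fun d => ?_
  rcases d with j | k
  · simp only [deviation, meanObs, Pi.sub_apply, Sum.elim_inl]
    fun_prop
  · simp only [deviation, meanObs, Pi.sub_apply, Sum.elim_inr]
    fun_prop

theorem continuous_shiftedParam : Continuous (shiftedParam c A Θ) := by
  unfold shiftedParam
  fun_prop

theorem obsDensity_eq_exp {x : Param I K} (hx : x.2.2.PosDef) (r : Obs I K → ℝ) :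
    obsDensity c x r = Real.exp (-(1 / 2) * ((I + K) * Real.log (2 * Real.pi) +
      Real.log x.2.2.det +
      (r - meanObs c x.1 x.2.1) ⬝ᵥ (x.2.2⁻¹ *ᵥ (r - meanObs c x.1 x.2.1)))) := by
  have hpi : (0 : ℝ) < (2 * Real.pi) ^ (I + K) := by positivity
  have hpos : 0 < (2 * Real.pi) ^ (I + K) * x.2.2.det := mul_pos hpi hx.det_pos
  rw [obsDensity, ← Real.exp_log (Real.sqrt_pos.2 hpos), Real.log_sqrt hpos.le, ← Real.exp_neg,
    ← Real.exp_add, Real.log_mul hpi.ne' hx.det_pos.ne', Real.log_pow]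
  push_cast
  ring_nf

theorem likelihood_eq_exp (e : ℕ → Obs I K → ℝ) {t : ℕ} (ht : 0 < t) {x : Param I K}
    (hx : x.2.2.PosDef) :
    likelihood c (fun t d => meanObs c A Θ d + e t d) t x =
      Real.exp (-(t / 2) * ((I + K) * Real.log (2 * Real.pi) + avgLoss c A Θ e t x)) := by
  have ht' : (t : ℝ) ≠ 0 := by exact_mod_cast ht.ne'
  have hr : ∀ z, (fun d => meanObs c A Θ d + e z d) - meanObs c x.1 x.2.1 =
      e z + deviation c A Θ x := fun z => by
    ext d
    simp only [deviation, Pi.sub_apply, Pi.add_apply]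
    ring
  simp only [likelihood, obsDensity_eq_exp c hx, hr]
  rw [← Real.exp_sum, ← Finset.mul_sum, Finset.sum_add_distrib, Finset.sum_const,
    Finset.card_range, nsmul_eq_mul, avgLoss]
  congr 1
  field_simp
  ring

theorem continuousAt_matrix_inv {n : Type*} [Fintype n] [DecidableEq n] {S : Matrix n n ℝ}
    (hS : S.det ≠ 0) : ContinuousAt (fun M : Matrix n n ℝ => M⁻¹) S := by
  simp only [Matrix.inv_def, Ring.inverse_eq_inv']
  have h1 : ContinuousAt (fun M : Matrix n n ℝ => M.det) S := continuous_id.matrix_det.continuousAt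
  exact (h1.inv₀ hS).smul continuous_id.matrix_adjugate.continuousAt

theorem continuousAt_trace_inv_mul_shiftedCov (v : Obs I K → ℝ) {x : Param I K}
    (hx : x.2.2.PosDef) :
    ContinuousAt (fun y : Param I K => (y.2.2⁻¹ * shiftedCov v (deviation c A Θ y)).trace) x := by
  have h1 : ContinuousAt (fun y : Param I K => y.2.2⁻¹) x :=
    (continuousAt_matrix_inv hx.det_pos.ne').comp (f := fun y : Param I K => y.2.2)
      (continuous_snd.comp continuous_snd).continuousAt
  have hd := continuous_deviation c A Θ
  have h2 : Continuous (fun y : Param I K => shiftedCov v (deviation c A Θ y)) :=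
    continuous_const.add (hd.matrix_vecMulVec hd)
  simp only [trace_mul_shiftedCov]
  have hentry : ∀ i j, ContinuousAt (fun y : Param I K => y.2.2⁻¹ i j) x := fun i j =>
    (continuous_id.matrix_elem i j).continuousAt.comp h1
  have hdev : ∀ i, ContinuousAt (fun y : Param I K => deviation c A Θ y i) x := fun i =>
    ((continuous_apply i).comp hd).continuousAt
  simp only [dotProduct, Matrix.mulVec]
  fun_prop

theorem continuousAt_gaussLoss_deviation (v : Obs I K → ℝ) {x : Param I K} (hx : x.2.2.PosDef) :
    ContinuousAt (fun y : Param I K => gaussLoss v (deviation c A Θ y) y.2.2) x := by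
  have h1 : ContinuousAt (fun y : Param I K => y.2.2.det) x :=
    (continuous_snd.comp continuous_snd).matrix_det.continuousAt
  exact (h1.log hx.det_pos.ne').add (continuousAt_trace_inv_mul_shiftedCov c A Θ v hx)

variable {c A Θ}

/-- These weights cancel every `θ`, so knowing `a_i` fixes this functional of the deviation. -/
theorem sum_mul_deviation {i : Fin I} (x : Param I K) :
    ∑ d, (Sum.elim (Pi.single i 1) (fun k => -c i k) : Obs I K → ℝ) d * deviation c A Θ x d =
      A i - x.1 i := by
  simp only [Fintype.sum_sum_type, Sum.elim_inl, Sum.elim_inr, Pi.single_apply, ite_mul, one_mul,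
    zero_mul, Finset.sum_ite_eq', Finset.mem_univ, if_true, deviation, meanObs, Pi.sub_apply,
    mul_sub, neg_mul, Finset.sum_sub_distrib, Finset.sum_neg_distrib]
  ring

/-- Pythagoras: for the inner product weighted by `1 / v`, `δ₀` is normal to the hyperplane on which
`w · δ` is constant. -/
theorem mahalanobisSq_eq_add {n : Type*} [Fintype n] {v : n → ℝ} (hv : ∀ i, 0 < v i) (w : n → ℝ)
    (s : ℝ) {δ δ₀ : n → ℝ} (hδ₀ : ∀ i, δ₀ i = s * (v i * w i))
    (h : ∑ i, w i * δ i = ∑ i, w i * δ₀ i) :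
    mahalanobisSq v δ = mahalanobisSq v δ₀ + mahalanobisSq v (δ - δ₀) := by
  have hcross : ∑ i, 2 * s * (w i * δ i - w i * δ₀ i) = 0 := by
    rw [← Finset.mul_sum, Finset.sum_sub_distrib, h, sub_self, mul_zero]
  rw [mahalanobisSq, mahalanobisSq, mahalanobisSq, ← Finset.sum_add_distrib,
    ← add_zero (∑ i, (_ + _)), ← hcross, ← Finset.sum_add_distrib]
  refine Finset.sum_congr rfl fun i _ => ?_
  rw [Pi.sub_apply, hδ₀ i]
  have := (hv i).ne'
  field_simp
  ring

/-- Beliefs concentrate on the parameter that minimizes the expected loss. -/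
theorem concentratesOn_shiftedParam {v : Obs I K → ℝ} (hv : ∀ d, 0 < v d)
    {e : ℕ → Obs I K → ℝ}
    (h1 : ∀ d, Tendsto (fun t : ℕ => (∑ z ∈ Finset.range t, e z d) / t) atTop (𝓝 0))
    (h2 : ∀ d d', Tendsto (fun t : ℕ => (∑ z ∈ Finset.range t, e z d * e z d') / t) atTop
      (𝓝 (Matrix.diagonal v d d')))
    {i : Fin I} {ai : ℝ} {P₀ : Measure (Param I K)} (hP₀ : IsPrior i ai P₀) {δ₀ : Obs I K → ℝ}
    (hpyth : ∀ x ∈ possible (K := K) i ai, mahalanobisSq v (deviation c A Θ x) =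
      mahalanobisSq v δ₀ + mahalanobisSq v (deviation c A Θ x - δ₀))
    (hmem : ((shiftedParam c A Θ δ₀).1, (shiftedParam c A Θ δ₀).2, shiftedCov v δ₀) ∈
      possible i ai) :
    ConcentratesOn (posterior c P₀ (fun t d => meanObs c A Θ d + e t d))
      ((shiftedParam c A Θ δ₀).1, (shiftedParam c A Θ δ₀).2, shiftedCov v δ₀) := by
  intro B hB hxB
  have := hP₀.isProbabilityMeasure
  set x₀ : Param I K :=
    ((shiftedParam c A Θ δ₀).1, (shiftedParam c A Θ δ₀).2, shiftedCov v δ₀) with hx₀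
  have hdev₀ : deviation c A Θ x₀ = δ₀ := deviation_shiftedParam c A Θ δ₀ _
  set G : Param I K → ℝ := fun x => gaussLoss v (deviation c A Θ x) x.2.2 with hG
  set T : Param I K → ℝ := fun x => (x.2.2⁻¹ * shiftedCov v (deviation c A Θ x)).trace with hT
  set G₀ := gaussLoss v δ₀ (shiftedCov v δ₀) with hG₀
  have hle : ∀ x ∈ possible (K := K) i ai,
      mahalanobisSq v δ₀ ≤ mahalanobisSq v (deviation c A Θ x) := fun x hx => by
    rw [hpyth x hx]
    exact le_add_of_nonneg_right (mahalanobisSq_nonneg hv _)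
  have hGmin : ∀ x ∈ possible (K := K) i ai, G₀ ≤ G x := fun x hx =>
    gaussLoss_shiftedCov_le hv (hle x hx) hx.2
  have hTnn : ∀ x ∈ possible (K := K) i ai, 0 ≤ T x := fun x hx =>
    trace_inv_mul_shiftedCov_nonneg hv _ hx.2
  obtain ⟨r, hr, hsep⟩ : ∃ r > 0, ∀ x ∈ possible i ai, G x < G₀ + 3 * r → x ∈ B := by
    -- Along this filter the loss tends to its minimum within the possible set. Well-separation
    -- makes it converge to `x₀`, so it contains `B`; unfolding that yields the gap `3 * r`.
    set l : Filter (Param I K) := comap G (𝓝 G₀) ⊓ 𝓟 (possible i ai) with hl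
    have hposs : ∀ᶠ x in l, x ∈ possible i ai := mem_inf_of_right (mem_principal_self _)
    have hlim := tendsto_of_tendsto_gaussLoss (l := l) hv (δ := deviation c A Θ)
      (S := fun x => x.2.2) (hposs.mono fun x hx => hx.2) (hposs.mono hpyth)
      (tendsto_comap.mono_left inf_le_left)
    have h3 : Tendsto (fun x : Param I K => (x.1, x.2.1)) l (𝓝 (shiftedParam c A Θ δ₀)) := by
      have := ((continuous_shiftedParam c A Θ).tendsto δ₀).comp hlim.1
      exact this.congr fun x => shiftedParam_deviation c A Θ x
    have h4 : Tendsto (fun x : Param I K => x) l (𝓝 x₀) :=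
      ((continuous_fst.tendsto _).comp h3).prodMk_nhds
        (((continuous_snd.tendsto _).comp h3).prodMk_nhds hlim.2)
    have h5 : B ∈ l := h4 (hB.mem_nhds hxB)
    rw [hl, mem_inf_principal, mem_comap] at h5
    obtain ⟨U, hU, hUB⟩ := h5
    obtain ⟨r, hr, hrU⟩ := Metric.mem_nhds_iff.1 hU
    refine ⟨r / 3, by positivity, fun x hx hxr => hUB (hrU ?_) hx⟩
    rw [Metric.mem_ball, Real.dist_eq, abs_of_nonneg (sub_nonneg.2 (hGmin x hx))]
    linarith
  set n : ℝ := (Fintype.card (Obs I K) : ℝ) with hn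
  have hn0 : 0 ≤ n := Nat.cast_nonneg _
  have hlog2 : 0 ≤ Real.log 2 := Real.log_nonneg one_le_two
  have hhalf : ∀ x ∈ possible (K := K) i ai, G₀ - n * Real.log 2 ≤
      Real.log x.2.2.det + T x / 2 := fun x hx => le_log_det_add_half_trace hv (hle x hx) hx.2
  -- If the average loss is below `G₀ + r` and `η ≤ 1/4`, then `hhalf` leaves `T / 4 < r + n log 2`,
  -- that is, `T < C`.
  set C : ℝ := 4 * (r + n * Real.log 2) with hC
  have hCpos : 0 < C := by positivity
  -- `η * C ≤ r` gives `G < G₀ + 2 r` for such parameters, inside the gap; `η * (n + 1) ≤ r / 4`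
  -- keeps the average loss below `G₀ + r / 2` near `x₀`.
  obtain ⟨η, hη, hη4, hηC, hηn⟩ :
      ∃ η : ℝ, 0 < η ∧ η ≤ 1 / 4 ∧ η * C ≤ r ∧ η * (n + 1) ≤ r / 4 := by
    refine ⟨min (1 / 4) (min (r / C) (r / 4 / (n + 1))), by positivity, min_le_left _ _, ?_, ?_⟩
    · rw [← le_div_iff₀ hCpos]
      exact (min_le_right _ _).trans (min_le_left _ _)
    · rw [← le_div_iff₀ (by positivity)]
      exact (min_le_right _ _).trans (min_le_right _ _)
  have hT₀ : T x₀ = n := by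
    simp only [hT, hdev₀]
    exact trace_inv_shiftedCov_mul_self hv δ₀
  have hGx₀ : G x₀ = G₀ := by
    simp only [hG, hdev₀]
    rfl
  have hnear : ∀ᶠ x in 𝓝 x₀, G x < G₀ + r / 4 ∧ T x < n + 1 := by
    have hGc := continuousAt_gaussLoss_deviation c A Θ v hmem.2
    have hTc := continuousAt_trace_inv_mul_shiftedCov c A Θ v hmem.2
    exact (hGc.eventually_lt_const (show G x₀ < G₀ + r / 4 by linarith)).and
      (hTc.eventually_lt_const (show T x₀ < n + 1 by linarith))
  obtain ⟨N, hN, hNopen, hxN⟩ := eventually_nhds_iff.1 hnear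
  have hNpos : 0 < P₀ N :=
    (Measure.mem_support_iff_forall x₀).1 (hP₀.full_support hmem) N (hNopen.mem_nhds hxN)
  have hunif : ∀ᶠ t : ℕ in atTop, ∀ x ∈ possible (K := K) i ai,
      |avgLoss c A Θ e t x - G x| ≤ η * T x := by
    filter_upwards [eventually_abs_avg_quadForm_sub_le hv h1 h2 hη] with t ht x hx
    have := ht x.2.2⁻¹ hx.2.inv.posSemidef (deviation c A Θ x)
    simpa only [avgLoss, hG, gaussLoss, add_sub_add_left_eq_sub] using this
  have hGT : ∀ x, G x = Real.log x.2.2.det + T x := fun x => rfl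
  set κ : ℝ := (I + K) * Real.log (2 * Real.pi) with hκ
  refine tendsto_likelihoodShare_one (f := fun t x => κ + avgLoss c A Θ e t x)
    (a := κ + (G₀ + r / 2)) (b := κ + (G₀ + r)) (m := κ + (G₀ - n * Real.log 2)) hP₀.ae_mem
    (fun t ht x hx => likelihood_eq_exp c A Θ e ht hx.2) hB.measurableSet hNopen.measurableSet
    hNpos (by linarith) ?_ ?_ ?_
  · filter_upwards [hunif] with t ht x hx
    have h3 := (abs_le.1 (ht x hx)).1
    have h4 := hhalf x hx
    have h5 := mul_le_mul_of_nonneg_right hη4 (hTnn x hx)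
    have h6 := hTnn x hx
    rw [hGT] at h3
    linarith
  · filter_upwards [hunif] with t ht x hx hxN'
    have h3 := (abs_le.1 (ht x hx)).2
    have h4 := hN x hxN'
    have h5 := mul_le_mul_of_nonneg_left h4.2.le hη.le
    linarith [h4.1]
  · filter_upwards [hunif] with t ht x hx hxB'
    by_contra! hlt
    refine hxB' (hsep x hx ?_)
    have h3 := (abs_le.1 (ht x hx)).1
    have h4 := hhalf x hx
    have h5 := mul_le_mul_of_nonneg_right hη4 (hTnn x hx)
    have hTC : T x ≤ C := by
      rw [hGT] at h3
      linarith
    have h6 := mul_le_mul_of_nonneg_left hTC hη.le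
    linarith

end Model

end SocialBeliefs

end

/-! ### The long-run biases -/

theorem proposition1 {I K : ℕ}
    -- group relationships, true calibers, true discrimination, variances of the errors
    (c : Fin I → Fin K → ℝ) (hc : ∀ j k, c j k = 1 ∨ c j k = 0 ∨ c j k = -1)
    (A : Fin I → ℝ) (Θ : Fin K → ℝ)
    (vq : Fin I → ℝ≥0) (vη : Fin K → ℝ≥0) (hvq : ∀ j, 0 < vq j) (hvη : ∀ k, 0 < vη k)
    -- the errors: independent across components and periods, normal with mean zero
    {Ω : Type*} [MeasurableSpace Ω] (P : Measure Ω) [IsProbabilityMeasure P]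
    (ε : ℕ → SocialBeliefs.Obs I K → Ω → ℝ)
    (hεq : ∀ t j, HasLaw (ε t (Sum.inl j)) (gaussianReal 0 (vq j)) P)
    (hεη : ∀ t k, HasLaw (ε t (Sum.inr k)) (gaussianReal 0 (vη k)) P)
    (hindep : iIndepFun (fun p : ℕ × SocialBeliefs.Obs I K => ε p.1 p.2) P)
    -- the overconfident agent and his prior
    (i : Fin I) (ai : ℝ) (hover : A i < ai)
    (P₀ : Measure (SocialBeliefs.Param I K)) (hP₀ : SocialBeliefs.IsPrior i ai P₀) :
    -- almost surely, beliefs concentrate on exactly one point, and it is deterministic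
    ∃ x : SocialBeliefs.Param I K,
      (∀ᵐ ω ∂P, ∀ y : SocialBeliefs.Param I K,
        SocialBeliefs.ConcentratesOn
          (SocialBeliefs.posterior c P₀
            (fun t d => SocialBeliefs.meanObs c A Θ d + ε t d ω)) y ↔ y = x) ∧
      x ∈ SocialBeliefs.possible i ai ∧
      (∀ k, x.2.1 k - Θ k =
        -(c i k) * vη k / (vq i + ∑ k', c i k' ^ 2 * vη k') * (ai - A i)) ∧
      (∀ j, j ≠ i → x.1 j - A j =
        (∑ k, c i k * c j k * vη k) / (vq i + ∑ k, c i k ^ 2 * vη k) * (ai - A i)) := by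
  classical
  set v : SocialBeliefs.Obs I K → ℝ≥0 := Sum.elim vq vη with hvdef
  have hv : ∀ d, (0 : ℝ) < v d := by
    rintro (j | k)
    · exact_mod_cast hvq j
    · exact_mod_cast hvη k
  have hlaw : ∀ t d, HasLaw (ε t d) (gaussianReal 0 (v d)) P := by
    rintro t (j | k)
    · exact hεq t j
    · exact hεη t k
  set w : SocialBeliefs.Obs I K → ℝ := Sum.elim (Pi.single i 1) (fun k => -c i k) with hw
  set D : ℝ := vq i + ∑ k, c i k ^ 2 * vη k with hD
  have hDpos : 0 < D := add_pos_of_pos_of_nonneg (by exact_mod_cast hvq i)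
    (Finset.sum_nonneg fun k _ => mul_nonneg (sq_nonneg _) (vη k).2)
  -- The least-norm solution of `w · δ = A i - ai`; its normalization is `D = ∑ v_d w_d²`.
  set δ₀ : SocialBeliefs.Obs I K → ℝ := fun d => (A i - ai) / D * (v d * w d) with hδ₀
  have hwδ₀ : ∑ d, w d * δ₀ d = A i - ai := by
    have h1 : ∑ d, w d * (v d * w d) = D := by
      simp only [hw, hvdef, hD, Fintype.sum_sum_type, Sum.elim_inl, Sum.elim_inr, Pi.single_apply,
        ite_mul, mul_ite, one_mul, mul_one, zero_mul, mul_zero, Finset.sum_ite_eq',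
        Finset.mem_univ, if_true]
      congr 1
      exact Finset.sum_congr rfl fun k _ => by ring
    calc ∑ d, w d * δ₀ d = (A i - ai) / D * ∑ d, w d * (v d * w d) := by
          rw [Finset.mul_sum]
          exact Finset.sum_congr rfl fun d _ => by simp only [hδ₀]; ring
      _ = A i - ai := by rw [h1, div_mul_cancel₀ _ hDpos.ne']
  set x₀ : SocialBeliefs.Param I K := ((SocialBeliefs.shiftedParam c A Θ δ₀).1,
    (SocialBeliefs.shiftedParam c A Θ δ₀).2,
    SocialBeliefs.shiftedCov (fun d => (v d : ℝ)) δ₀) with hx₀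
  have hmem : x₀ ∈ SocialBeliefs.possible i ai := by
    refine ⟨?_, SocialBeliefs.posDef_shiftedCov hv δ₀⟩
    have h1 := SocialBeliefs.sum_mul_deviation (c := c) (A := A) (Θ := Θ) (i := i) x₀
    rw [hx₀, SocialBeliefs.deviation_shiftedParam] at h1
    linarith [h1.symm.trans hwδ₀]
  refine ⟨x₀, ?_, hmem, fun k => ?_, fun j hj => ?_⟩
  · have h1 := ae_all_iff.2 fun d => SocialBeliefs.ae_tendsto_avg_error hlaw hindep d
    have h2 := ae_all_iff.2 fun d => ae_all_iff.2 fun d' =>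
      SocialBeliefs.ae_tendsto_avg_error_mul_error hlaw hindep d d'
    filter_upwards [h1, h2] with ω hω1 hω2 y
    have hconc : SocialBeliefs.ConcentratesOn (SocialBeliefs.posterior c P₀
        (fun t d => SocialBeliefs.meanObs c A Θ d + ε t d ω)) x₀ :=
      SocialBeliefs.concentratesOn_shiftedParam (e := fun t d => ε t d ω) hv hω1 hω2 hP₀
        (fun x hx => SocialBeliefs.mahalanobisSq_eq_add hv w ((A i - ai) / D) (fun _ => rfl) (by
          rw [hwδ₀, SocialBeliefs.sum_mul_deviation, hx.1])) hmem
    exact ⟨fun hy => SocialBeliefs.ConcentratesOn.eq hconc hy, fun hy => hy ▸ hconc⟩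
  · simp only [hx₀, SocialBeliefs.shiftedParam, hδ₀, hw, hvdef, Sum.elim_inr]
    ring
  · have hsum : ∑ k, c j k * δ₀ (Sum.inr k) =
        (∑ k, c i k * c j k * vη k) * ((ai - A i) / D) := by
      rw [Finset.sum_mul]
      refine Finset.sum_congr rfl fun k _ => ?_
      simp only [hδ₀, hw, hvdef, Sum.elim_inr]
      ring
    -- Since `w` vanishes at `q_j`, the bias about `j` comes solely from the biased levels of
    -- discrimination.
    have hj0 : δ₀ (Sum.inl j) = 0 := by simp [hδ₀, hw, hj]
    simp only [hx₀, SocialBeliefs.shiftedParam, hsum, hj0]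
    ring
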